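/- Let $S$ be a connected closed surface (in particular, any connected closed oriented surface; orientability is not needed). A *knot diagram* on $S$ is a closed curve $D\colon S^1\to S$ with finitely many double points, all transverse, and no points of higher multiplicity, together with a choice of the over-passing branch at each double point; a *flat diagram* is such a curve without the over/under information. The set of double points (crossings) is denoted $\mathcal V(D)$. A *knot* (resp. *flat knot*) $\mathcal K$ on $S$ is a class of knot diagrams (resp. flat diagrams) modulo isotopies and the Reidemeister moves $R1,R2,R3$. Its category of diagrams $\mathfrak K$ has the diagrams of $\mathcal K$ as objects, and formal compositions of isotopies and (increasing or decreasing) Reidemeister moves as morphisms. An isotopy or Reidemeister move $f\colon D\to D'$ induces a partial map $f_*\colon\mathcal V(D)\to\mathcal V(D')$ between corresponding crossings; it is defined on all crossings for isotopies and third moves, and on all crossings that do not participate in the move for first and second moves. A *weak parity* on $\mathfrak K$ is a family of maps $\psi_D\colon\mathcal V(D)\to\mathbb Z_2=\{0,1\}$, $D\in\mathrm{ob}(\mathfrak K)$, such that - ($\Psi 0$) for every isotopy or Reidemeister move $f\colon D\to D'$ and every crossing $v\in\mathcal V(D)$ not participating in $f$, $\psi_D(v)=\psi_{D'}(f_*(v))$;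 - ($\Psi 2$) if $f\colon D\to D'$ is a decreasing second Reidemeister move in which the crossings $u,v\in\mathcal V(D)$ participate, then $\psi_D(u)=\psi_D(v)$; - ($\Psi 3$) if $f\colon D\to D'$ is a third Reidemeister move in which the crossings $u,v,w\in\mathcal V(D)$ participate, then $\psi_D(x)=\psi_{D'}(f_*(x))$ for $x\in\{u,v,w\}$, and $\psi_D(u)+\psi_D(v)+\psi_D(w)\neq 1$ as an integer, i.e. the number of $x\in\{u,v,w\}$ with $\psi_D(x)=1$ is not one. At a crossing $v$ the curve $D$ splits into two loops based at $v$, the *halves* $D_v$ and $D'_v$ of $D$ at $v$, and $[D]\in\pi_1(S,v)$ denotes the class $[D_v][D'_v]$ of the whole curve traversed from $v$. Put $\psi^{hom}_D(v)=0$ if $[D_v]=[D]^l$ in $\pi_1(S,v)$ for some $l\in\mathbb Z$, and $\psi^{hom}_D(v)=1$ otherwise. (The condition does not depend on which of the two halves is taken as $D_v$, nor on the order of the factors in $[D]$.) **Proposition.** For every knot and for every flat knot $\mathcal K$ on $S$, the family of maps $\psi^{hom}_D$, $D\in\mathrm{ob}(\mathfrak K)$, is a weak parity on $\mathfrak K$;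 that is, it satisfies ($\Psi 0$), ($\Psi 2$) and ($\Psi 3$). -/

import Mathlib

open Set Topology

noncomputable section

namespace SurfaceKnots

variable {S : Type*} [TopologicalSpace S]

/-! ### Diagrams on a surface -/

/-- A flat (plane) knot diagram on `S`: a closed curve in general position, i.e. a closed curve
with finitely many double points, all of them transverse, and no points of higher multiplicity.
Its image is an embedded 4-valent graph (or a circle without vertices) in which the curve passes
from each half-edge to the opposite one, so that there is one unicursal component.
Transversality: in suitable local coordinates at the double point one branch runs along the first
coordinate axis and the other one along the second. -/
structure FlatDiagram (S : Type*) [TopologicalSpace S] where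
  curve : C(UnitAddCircle, S)
  finite_double : {v : S | ∃ s t, s ≠ t ∧ curve s = v ∧ curve t = v}.Finite
  no_triple : ∀ r s t, curve r = curve s → curve s = curve t → r = s ∨ s = t ∨ r = t
  transverse : ∀ s t, s ≠ t → curve s = curve t →
    ∃ e : OpenPartialHomeomorph S (EuclideanSpace ℝ (Fin 2)),
      curve s ∈ e.source ∧ e (curve s) = 0 ∧
      (∀ᶠ x in 𝓝 s, e (curve x) 1 = 0) ∧ (∀ᶠ x in 𝓝 t, e (curve x) 0 = 0)

/-- The set of (classical) crossings of a diagram. -/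
def FlatDiagram.Crossing (D : FlatDiagram S) : Type _ :=
  {v : S // ∃ s t, s ≠ t ∧ D.curve s = v ∧ D.curve t = v}

/-- The periodic parametrization of the diagram by the real line. -/
def FlatDiagram.at (D : FlatDiagram S) (x : ℝ) : S := D.curve (x : UnitAddCircle)

/-- A knot diagram on `S`: a flat diagram together with the choice, at every crossing, of the
branch that passes over (recorded by its parameter). -/
structure KnotDiagram (S : Type*) [TopologicalSpace S] extends FlatDiagram S where
  upper : toFlatDiagram.Crossing → UnitAddCircle
  upper_spec : ∀ c, curve (upper c) = c.1

/-! ### Elementary morphisms: isotopies and Reidemeister moves -/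

/-- A closed disc embedded in `S`. -/
structure Disc (S : Type*) [TopologicalSpace S] where
  toFun : Metric.closedBall (0 : EuclideanSpace ℝ (Fin 2)) 1 → S
  isEmbedding : IsEmbedding toFun

/-- The points of the disc. -/
def Disc.carrier (B : Disc S) : Set S := range B.toFun

/-- The points of the disc that do not lie on its boundary circle. -/
def Disc.interior (B : Disc S) : Set S := B.toFun '' {x | ‖x.1‖ < 1}

/-- The diagrams `D` and `D'` coincide outside a disc, and each of them meets the disc in `k`
proper strands with common endpoints on the boundary circle.  The strands are the images of the
disjoint parameter arcs `[start i, fin i]`, numbered in the order in which the knot traverses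
them. -/
structure LocalChange (D D' : FlatDiagram S) (k : ℕ) where
  disc : Disc S
  start : Fin k → ℝ
  fin : Fin k → ℝ
  start_lt_fin : ∀ i, start i < fin i
  fin_lt_start : ∀ i j, i < j → fin i < start j
  fin_lt_period : ∀ i j, fin i < start j + 1
  preimage_disc : D.curve ⁻¹' disc.carrier =
    ⋃ i, ((↑) : ℝ → UnitAddCircle) '' Icc (start i) (fin i)
  preimage_interior : D.curve ⁻¹' disc.interior =
    ⋃ i, ((↑) : ℝ → UnitAddCircle) '' Ioo (start i) (fin i)
  preimage_disc' : D'.curve ⁻¹' disc.carrier =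
    ⋃ i, ((↑) : ℝ → UnitAddCircle) '' Icc (start i) (fin i)
  preimage_interior' : D'.curve ⁻¹' disc.interior =
    ⋃ i, ((↑) : ℝ → UnitAddCircle) '' Ioo (start i) (fin i)
  agree : ∀ x, D.curve x ∉ disc.interior → D.curve x = D'.curve x

/-- The open parameter arc of the `i`-th strand. -/
def LocalChange.strand {D D' : FlatDiagram S} {k : ℕ} (m : LocalChange D D' k) (i : Fin k) :
    Set UnitAddCircle :=
  ((↑) : ℝ → UnitAddCircle) '' Ioo (m.start i) (m.fin i)

/-- The inverse change. -/
def LocalChange.symm {D D' : FlatDiagram S} {k : ℕ} (m : LocalChange D D' k) :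
    LocalChange D' D k where
  disc := m.disc
  start := m.start
  fin := m.fin
  start_lt_fin := m.start_lt_fin
  fin_lt_start := m.fin_lt_start
  fin_lt_period := m.fin_lt_period
  preimage_disc := m.preimage_disc'
  preimage_interior := m.preimage_interior'
  preimage_disc' := m.preimage_disc
  preimage_interior' := m.preimage_interior
  agree x hx := by
    refine (m.agree x ?_).symm
    have h : x ∈ D'.curve ⁻¹' m.disc.interior ↔ x ∈ D.curve ⁻¹' m.disc.interior := by
      rw [m.preimage_interior, m.preimage_interior']
    exact fun h' => hx (h.2 h')

/-- A crossing outside the disc is a crossing of the new diagram too. -/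
def LocalChange.push {D D' : FlatDiagram S} {k : ℕ} (m : LocalChange D D' k) (v : D.Crossing)
    (hv : v.1 ∉ m.disc.interior) : D'.Crossing :=
  ⟨v.1, by
    obtain ⟨s, t, hst, hs, ht⟩ := v.2
    refine ⟨s, t, hst, ?_, ?_⟩
    · rw [← m.agree s (by rwa [hs]), hs]
    · rw [← m.agree t (by rwa [ht]), ht]⟩

/-- A decreasing first Reidemeister move (flat version): a strand with the single self-crossing
`u` is replaced by a strand without crossings. -/
structure R1Move (D D' : FlatDiagram S) extends LocalChange D D' 1 where
  u : D.Crossing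
  u_mem : u.1 ∈ disc.interior
  mem_disc_iff : ∀ c : D.Crossing, c.1 ∈ disc.carrier ↔ c = u
  notMem_disc' : ∀ c : D'.Crossing, c.1 ∉ disc.carrier

/-- A decreasing second Reidemeister move (flat version): two strands that cross each other exactly
twice, at `u` and `v`, and have no other crossings, are replaced by two strands without
crossings. -/
structure R2Move (D D' : FlatDiagram S) extends LocalChange D D' 2 where
  u : D.Crossing
  v : D.Crossing
  u_ne_v : u ≠ v
  u_mem : ∀ i, ∃ x ∈ toLocalChange.strand i, D.curve x = u.1
  v_mem : ∀ i, ∃ x ∈ toLocalChange.strand i, D.curve x = v.1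
  mem_disc_iff : ∀ c : D.Crossing, c.1 ∈ disc.carrier ↔ c = u ∨ c = v
  notMem_disc' : ∀ c : D'.Crossing, c.1 ∉ disc.carrier

/-- A third Reidemeister move (flat version): three strands without self-crossings, any two of
which cross exactly once, are replaced by three such strands with the same endpoints, and along
each strand the order of its two crossings is reversed.
The crossing of the two strands other than the strand `k` is `c k` in the old diagram and `c' k`
in the new one, and `p i k`, `p' i k` are its parameters on the strand `i ≠ k`. -/
structure R3Move (D D' : FlatDiagram S) extends LocalChange D D' 3 where
  c : Fin 3 → D.Crossing
  c' : Fin 3 → D'.Crossing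
  p : Fin 3 → Fin 3 → ℝ
  p' : Fin 3 → Fin 3 → ℝ
  p_mem : ∀ i k, i ≠ k → p i k ∈ Ioo (start i) (fin i)
  p_mem' : ∀ i k, i ≠ k → p' i k ∈ Ioo (start i) (fin i)
  at_p : ∀ i k, i ≠ k → D.at (p i k) = (c k).1
  at_p' : ∀ i k, i ≠ k → D'.at (p' i k) = (c' k).1
  mem_disc_iff : ∀ x : D.Crossing, x.1 ∈ disc.carrier ↔ ∃ k, x = c k
  mem_disc_iff' : ∀ x : D'.Crossing, x.1 ∈ disc.carrier ↔ ∃ k, x = c' k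
  reversed : ∀ i j k, i ≠ j → i ≠ k → (p i j < p i k ↔ p' i k < p' i j)

/-- An isotopy of diagrams: an ambient isotopy of `S` that carries the first diagram to the second
one.  Diagrams are not distinguished up to reparametrization of the circle, orientation-preserving
or not; `reparam` is a lift to the real line of a homeomorphism of the circle of degree `sgn`. -/
structure Isotopy (D D' : FlatDiagram S) where
  F : C(unitInterval × S, S)
  isHomeomorph : ∀ t, IsHomeomorph fun x => F (t, x)
  F_zero : ∀ x, F (0, x) = x
  reparam : ℝ ≃ₜ ℝ
  sgn : ℤˣ
  reparam_add_one : ∀ x, reparam (x + 1) = reparam x + ((sgn : ℤ) : ℝ)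
  map_curve : ∀ x, D'.at x = F (1, D.at (reparam x))

theorem coe_eq_coe_iff {x y : ℝ} : (x : UnitAddCircle) = y ↔ ∃ n : ℤ, y = x + n := by
  rw [eq_comm, ← sub_eq_zero, ← AddCircle.coe_sub, AddCircle.coe_eq_zero_iff]
  simp only [zsmul_eq_mul, mul_one, eq_sub_iff_add_eq]
  exact exists_congr fun n => by rw [add_comm, eq_comm]

theorem Isotopy.reparam_add_int {D D' : FlatDiagram S} (f : Isotopy D D') (x : ℝ) (n : ℤ) :
    f.reparam (x + n) = f.reparam x + ((n * f.sgn : ℤ) : ℝ) := by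
  induction n with
  | zero => simp
  | succ n ih =>
    have h := f.reparam_add_one (x + n)
    push_cast at h ih ⊢
    rw [← add_assoc, h, ih]; ring
  | pred n ih =>
    have h := f.reparam_add_one (x + (-n - 1))
    have e : x + (-n - 1) + 1 = x + (-n : ℝ) := by ring
    rw [e] at h
    push_cast at h ih ⊢
    linear_combination ih - h

/-- The image of a crossing under an isotopy. -/
def Isotopy.push {D D' : FlatDiagram S} (f : Isotopy D D') (v : D.Crossing) : D'.Crossing :=
  ⟨f.F (1, v.1), by
    obtain ⟨s, t, hst, hs, ht⟩ := v.2
    obtain ⟨x, rfl⟩ := QuotientAddGroup.mk_surjective s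
    obtain ⟨y, rfl⟩ := QuotientAddGroup.mk_surjective t
    refine ⟨((f.reparam.symm x : ℝ) : UnitAddCircle), ((f.reparam.symm y : ℝ) : UnitAddCircle),
      ?_, ?_, ?_⟩
    · intro h
      obtain ⟨n, hn⟩ := coe_eq_coe_iff.1 h
      refine hst (coe_eq_coe_iff.2 ⟨n * f.sgn, ?_⟩)
      have h2 := f.reparam_add_int (f.reparam.symm x) n
      rwa [← hn, Homeomorph.apply_symm_apply, Homeomorph.apply_symm_apply] at h2
    · have h := f.map_curve (f.reparam.symm x)
      rw [Homeomorph.apply_symm_apply] at h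
      rw [← hs]; exact h
    · have h := f.map_curve (f.reparam.symm y)
      rw [Homeomorph.apply_symm_apply] at h
      rw [← ht]; exact h⟩

/-- The elementary morphisms between flat diagrams: isotopies, decreasing and increasing first and
second Reidemeister moves, and third Reidemeister moves. -/
inductive Move (D D' : FlatDiagram S) where
  | isotopy (f : Isotopy D D')
  | r1 (m : R1Move D D')
  | r1Inv (m : R1Move D' D)
  | r2 (m : R2Move D D')
  | r2Inv (m : R2Move D' D)
  | r3 (m : R3Move D D')

/-- The crossings of the first diagram that participate in the elementary morphism. -/
def Move.participants {D D' : FlatDiagram S} : Move D D' → Set D.Crossing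
  | .isotopy _ => ∅
  | .r1 m => {m.u}
  | .r1Inv _ => ∅
  | .r2 m => {m.u, m.v}
  | .r2Inv _ => ∅
  | .r3 m => range m.c

theorem Disc.mem_carrier {B : Disc S} {x : S} (h : x ∈ B.interior) : x ∈ B.carrier := by
  obtain ⟨y, -, rfl⟩ := h
  exact ⟨y, rfl⟩

/-- The map `f_*` induced by an elementary morphism on the crossings that do not participate in it.
(A third Reidemeister move moreover takes the participant `c k` to `c' k`.) -/
def Move.push {D D' : FlatDiagram S} : (f : Move D D') → (v : D.Crossing) → v ∉ f.participants →
    D'.Crossing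
  | .isotopy f, v, _ => f.push v
  | .r1 m, v, hv => m.push v fun h => hv ((m.mem_disc_iff v).1 (Disc.mem_carrier h))
  | .r1Inv m, v, _ => m.symm.push v fun h => m.notMem_disc' v (Disc.mem_carrier h)
  | .r2 m, v, hv => m.push v fun h => hv ((m.mem_disc_iff v).1 (Disc.mem_carrier h))
  | .r2Inv m, v, _ => m.symm.push v fun h => m.notMem_disc' v (Disc.mem_carrier h)
  | .r3 m, v, hv => m.push v fun h => hv (by
      obtain ⟨k, hk⟩ := (m.mem_disc_iff v).1 (Disc.mem_carrier h)
      exact ⟨k, hk.symm⟩)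

/-- In a second move between knot diagrams one of the strands is the upper one at both crossings. -/
def R2Move.Layered {D : KnotDiagram S} {D' : FlatDiagram S} (m : R2Move D.toFlatDiagram D') :
    Prop :=
  ∃ i, D.upper m.u ∈ m.strand i ∧ D.upper m.v ∈ m.strand i

/-- In a third move between knot diagrams the strands lie at three levels, the same before and
after the move: at each crossing the strand of the greater height is the upper one. -/
def R3Move.Layered {D D' : KnotDiagram S} (m : R3Move D.toFlatDiagram D'.toFlatDiagram) : Prop :=
  ∃ height : Equiv.Perm (Fin 3), ∀ i j k, i ≠ k → j ≠ k → height j < height i →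
    D.upper (m.c k) = (m.p i k : UnitAddCircle) ∧ D'.upper (m.c' k) = (m.p' i k : UnitAddCircle)

/-- The over/under structure of an isotopy or move between knot diagrams: it is preserved at the
crossings that do not participate, and the participants are layered as the second and third
Reidemeister moves require. -/
def Move.IsKnotMove {D D' : KnotDiagram S} : Move D.toFlatDiagram D'.toFlatDiagram → Prop
  | .isotopy f => ∀ (v : D.Crossing) (x : ℝ), D'.upper (f.push v) = (x : UnitAddCircle) →
      D.upper v = (f.reparam x : UnitAddCircle)
  | .r1 m => ∀ v hv, D'.upper ((Move.r1 m).push v hv) = D.upper v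
  | .r1Inv m => ∀ v hv, D'.upper ((Move.r1Inv m).push v hv) = D.upper v
  | .r2 m => (∀ v hv, D'.upper ((Move.r2 m).push v hv) = D.upper v) ∧ m.Layered
  | .r2Inv m => (∀ v hv, D'.upper ((Move.r2Inv m).push v hv) = D.upper v) ∧ m.Layered
  | .r3 m => (∀ v hv, D'.upper ((Move.r3 m).push v hv) = D.upper v) ∧ m.Layered

/-! ### Knots and their categories of diagrams -/

/-- Knots on `S`: knot diagrams modulo isotopies and Reidemeister moves. -/
def Knot (S : Type*) [TopologicalSpace S] : Type _ :=
  Quot fun D D' : KnotDiagram S => ∃ f : Move D.toFlatDiagram D'.toFlatDiagram, f.IsKnotMove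

/-- Flat knots on `S`: flat diagrams modulo isotopies and Reidemeister moves. -/
def FlatKnot (S : Type*) [TopologicalSpace S] : Type _ :=
  Quot fun D D' : FlatDiagram S => Nonempty (Move D D')

/-- A category of diagrams on `S`, given by its objects (with their underlying flat diagrams) and
its elementary morphisms; the morphisms are the formal compositions of the latter. -/
structure DiagramCategory (S : Type*) [TopologicalSpace S] where
  Obj : Type*
  flat : Obj → FlatDiagram S
  IsElementary : ∀ {D D' : Obj}, Move (flat D) (flat D') → Prop

/-- The category of diagrams of a knot. -/
def Knot.diagrams (K : Knot S) : DiagramCategory S where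
  Obj := {D : KnotDiagram S // (Quot.mk _ D : Knot S) = K}
  flat D := D.1.toFlatDiagram
  IsElementary f := f.IsKnotMove

/-- The category of diagrams of a flat knot. -/
def FlatKnot.diagrams (K : FlatKnot S) : DiagramCategory S where
  Obj := {D : FlatDiagram S // (Quot.mk _ D : FlatKnot S) = K}
  flat D := D.1
  IsElementary _ := True

/-! ### Weak parities -/

/-- A family of maps `ψ D` from the crossings of `D` to `ℤ/2`, for the diagrams `D` of a category,
is a weak parity if it has the properties (Ψ0), (Ψ2), (Ψ3). -/
structure IsWeakParity (𝒦 : DiagramCategory S)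
    (ψ : ∀ D : 𝒦.Obj, (𝒦.flat D).Crossing → ZMod 2) : Prop where
  /-- (Ψ0): elementary morphisms preserve the parity of the crossings not participating in them. -/
  psi0 : ∀ (D D' : 𝒦.Obj) (f : Move (𝒦.flat D) (𝒦.flat D')), 𝒦.IsElementary f →
    ∀ v hv, ψ D v = ψ D' (f.push v hv)
  /-- (Ψ2): the crossings participating in a decreasing second move have equal parities. -/
  psi2 : ∀ (D D' : 𝒦.Obj) (m : R2Move (𝒦.flat D) (𝒦.flat D')), 𝒦.IsElementary (.r2 m) →
    ψ D m.u = ψ D m.v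
  /-- (Ψ3): a third move preserves the parities of its participants, and the number of odd ones
  among them is not one. -/
  psi3 : ∀ (D D' : 𝒦.Obj) (m : R3Move (𝒦.flat D) (𝒦.flat D')), 𝒦.IsElementary (.r3 m) →
    (∀ k, ψ D (m.c k) = ψ D' (m.c' k)) ∧
    (ψ D (m.c 0)).val + (ψ D (m.c 1)).val + (ψ D (m.c 2)).val ≠ 1

/-! ### The homotopy weak parity -/

theorem FlatDiagram.continuous_at (D : FlatDiagram S) : Continuous D.at :=
  D.curve.continuous.comp (AddCircle.continuous_mk' 1)

theorem FlatDiagram.at_add_int (D : FlatDiagram S) (x : ℝ) (n : ℤ) : D.at (x + n) = D.at x := by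
  have h : ((x + n : ℝ) : UnitAddCircle) = (x : UnitAddCircle) :=
    coe_eq_coe_iff.2 ⟨-n, by simp⟩
  simp only [FlatDiagram.at, h]

/-- The part of the diagram from the parameter `a` to the parameter `b`, as a path. -/
def FlatDiagram.arc (D : FlatDiagram S) (a b : ℝ) : Path (D.at a) (D.at b) :=
  (Path.segment a b).map D.continuous_at

/-- The homotopy class, in the fundamental group at `v`, of the part of the diagram from the
parameter `a` to the parameter `b`, if it starts and ends at `v`. -/
def FlatDiagram.loop (D : FlatDiagram S) {v : S} {a b : ℝ} (ha : D.at a = v) (hb : D.at b = v) :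
    FundamentalGroup S v :=
  FundamentalGroup.fromPath (Path.Homotopic.Quotient.mk ((D.arc a b).cast ha.symm hb.symm))

theorem FlatDiagram.at_add_one {D : FlatDiagram S} {v : S} {a : ℝ} (ha : D.at a = v) :
    D.at (a + 1) = v := by
  have h := D.at_add_int a 1
  rw [Int.cast_one] at h
  rw [h, ha]

/-- The crossing `v` is even: for a half of the knot at `v`, running from the parameter `a` to the
parameter `b`, the class of the half in the fundamental group of `S` at `v` is a power of the class
of the whole diagram.  (The other half runs from `b` to `a + 1`.) -/
def FlatDiagram.IsEven (D : FlatDiagram S) (v : D.Crossing) : Prop :=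
  ∃ (a b : ℝ) (ha : D.at a = v.1) (hb : D.at b = v.1), a < b ∧ b < a + 1 ∧
    ∃ l : ℤ, D.loop ha hb = D.loop ha (D.at_add_one ha) ^ l

theorem FlatDiagram.loop_mul (D : FlatDiagram S) {v : S} {a b c : ℝ} (ha : D.at a = v)
    (hb : D.at b = v) (hc : D.at c = v) : D.loop hb hc * D.loop ha hb = D.loop ha hc := by
  subst ha
  have h : ((Path.segment a b).trans (Path.segment b c)).Homotopic (Path.segment a c) :=
    SimplyConnectedSpace.paths_homotopic _ _
  have h' := h.map ⟨D.at, D.continuous_at⟩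
  rw [Path.map_trans] at h'
  rw [FundamentalGroup.mul_def]
  refine Eq.trans (Path.Homotopic.Quotient.mk_trans _ _).symm (Path.Homotopic.Quotient.eq.2 ?_)
  have e : ∀ {w : S} (hw : w = D.at c) (p : Path (D.at a) (D.at c))
      (q : Path (D.at a) (D.at c)), p.Homotopic q →
      (p.cast rfl hw).Homotopic (q.cast rfl hw) := by
    rintro w rfl p q hpq
    exact hpq
  refine Eq.mp ?_ (e hc.symm _ _ h')
  congr 1

theorem FlatDiagram.loop_add_int (D : FlatDiagram S) {v : S} {a b : ℝ} (n : ℤ) (ha : D.at a = v)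
    (hb : D.at b = v) (ha' : D.at (a + n) = v) (hb' : D.at (b + n) = v) :
    D.loop ha' hb' = D.loop ha hb := by
  refine congrArg Path.Homotopic.Quotient.mk ?_
  ext t
  have h : Path.segment (a + n) (b + n) t = Path.segment a b t + n := by
    simp [Path.segment, AffineMap.lineMap_apply]; ring
  simp only [FlatDiagram.arc, Path.cast_coe, Path.map_coe, Function.comp_apply, h, D.at_add_int]

theorem FlatDiagram.loop_congr (D : FlatDiagram S) {v : S} {a b a' b' : ℝ} (h : a = a')
    (h' : b = b') (ha : D.at a = v) (hb : D.at b = v) (ha' : D.at a' = v) (hb' : D.at b' = v) :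
    D.loop ha hb = D.loop ha' hb' := by
  subst h h'
  rfl

theorem exists_zpow_tfae {G : Type*} [Group G] (g h : G) :
    [∃ l : ℤ, g = (h * g) ^ l, ∃ l : ℤ, h = (h * g) ^ l,
      ∃ l : ℤ, g = (g * h) ^ l, ∃ l : ℤ, h = (g * h) ^ l].TFAE := by
  have key : ∀ x y : G, (∃ l : ℤ, x = (y * x) ^ l) → ∃ l : ℤ, y = (y * x) ^ l := by
    rintro x y ⟨l, hl⟩
    refine ⟨1 - l, ?_⟩
    rw [zpow_sub, ← hl]; simp
  have key' : ∀ x y : G, (∃ l : ℤ, x = (x * y) ^ l) → ∃ l : ℤ, y = (x * y) ^ l := by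
    rintro x y ⟨l, hl⟩
    refine ⟨-l + 1, ?_⟩
    rw [zpow_add, zpow_neg, ← hl]; simp
  have comm : ∀ x y : G, (∃ l : ℤ, x = (y * x) ^ l) → ∃ l : ℤ, x = (x * y) ^ l := by
    rintro x y ⟨l, hl⟩
    refine ⟨l, ?_⟩
    have h1 : Commute x (y * x) := by
      have := Commute.zpow_left (Commute.refl (y * x)) l
      rwa [← hl] at this
    have h2 : x * y = y * x := by
      have := h1.eq
      rw [← mul_assoc] at this
      exact mul_right_cancel this
    rwa [h2]
  tfae_have 1 → 2 := key g h
  tfae_have 1 → 3 := comm g h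
  tfae_have 3 → 4 := key' g h
  tfae_have 4 → 2 := comm h g
  tfae_have 2 → 1 := key' h g
  tfae_finish

/-- The evenness of a crossing does not depend on the choices: it may be tested on any one of its
halves, and the class of the diagram may be taken to be the product of the classes of the two
halves in any order. -/
theorem FlatDiagram.isEven_tfae (D : FlatDiagram S) (v : D.Crossing) {a b : ℝ} (hab : a < b)
    (hba : b < a + 1) (ha : D.at a = v.1) (hb : D.at b = v.1) :
    [D.IsEven v,
      ∃ l : ℤ, D.loop ha hb = D.loop ha (D.at_add_one ha) ^ l,
      ∃ l : ℤ, D.loop hb (D.at_add_one ha) = D.loop ha (D.at_add_one ha) ^ l,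
      ∃ l : ℤ, D.loop ha hb = D.loop hb (D.at_add_one hb) ^ l,
      ∃ l : ℤ, D.loop hb (D.at_add_one ha) = D.loop hb (D.at_add_one hb) ^ l].TFAE := by
  have e1 := D.loop_mul ha hb (D.at_add_one ha)
  have e2 := D.loop_mul hb (D.at_add_one ha) (D.at_add_one hb)
  have e3 : D.loop (D.at_add_one ha) (D.at_add_one hb) = D.loop ha hb := by
    simpa using D.loop_add_int 1 ha hb (by simpa using D.at_add_one ha)
      (by simpa using D.at_add_one hb)
  rw [e3] at e2
  have T := exists_zpow_tfae (D.loop ha hb) (D.loop hb (D.at_add_one ha))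
  rw [e1, e2] at T
  have h0 : D.IsEven v → ∃ l : ℤ, D.loop ha hb = D.loop ha (D.at_add_one ha) ^ l := by
    rintro ⟨x, y, hx, hy, hxy, hyx, l, hl⟩
    have mem : ∀ z : ℝ, D.at z = v.1 → (∃ n : ℤ, z = a + n) ∨ ∃ n : ℤ, z = b + n := by
      intro z hz
      rcases D.no_triple (a : UnitAddCircle) b z (ha.trans hb.symm) (hb.trans hz.symm) with h | h | h
      · obtain ⟨n, hn⟩ := coe_eq_coe_iff.1 h
        exfalso
        have h1 : (0 : ℝ) < n := by linarith
        have h2 : (n : ℝ) < 1 := by linarith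
        norm_cast at h1 h2
        omega
      · exact Or.inr (coe_eq_coe_iff.1 h)
      · exact Or.inl (coe_eq_coe_iff.1 h)
    have bd : ∀ n m : ℤ, (n : ℝ) < m + 1 → n ≤ m := fun n m h => by
      norm_cast at h
      omega
    rcases mem x hx with ⟨n, rfl⟩ | ⟨n, rfl⟩ <;> rcases mem y hy with ⟨m, rfl⟩ | ⟨m, rfl⟩
    · exfalso
      have h1 : (n : ℝ) < m := by linarith
      have h2 : (m : ℝ) < n + 1 := by linarith
      have := bd _ _ h2
      norm_cast at h1
      omega
    · have h1 := bd n m (by linarith)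
      have h2 := bd m n (by linarith)
      obtain rfl : n = m := le_antisymm h1 h2
      have h3 := D.loop_add_int n ha hb hx hy
      have h4 : D.loop hx (D.at_add_one hx) = D.loop ha (D.at_add_one ha) := by
        have e : a + 1 + n = a + n + 1 := by ring
        have := D.loop_add_int n ha (D.at_add_one ha) hx (by rw [e]; exact D.at_add_one hx)
        rw [← this]
        exact D.loop_congr rfl e.symm _ _ _ _
      exact ⟨l, by rw [← h3, hl, h4]⟩
    · have h1 := bd (n + 1) m (by
        have : (n : ℝ) < m := by linarith
        norm_cast at this
        exact_mod_cast (by omega : n + 1 < m + 1))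
      have h2 := bd m (n + 1) (by push_cast; linarith)
      obtain rfl : n + 1 = m := le_antisymm h1 h2
      have e : a + 1 + n = a + ((n + 1 : ℤ) : ℝ) := by push_cast; ring
      have e' : b + 1 + n = b + n + 1 := by ring
      have h3 := D.loop_add_int n hb (D.at_add_one ha) hx (by rw [e]; exact hy)
      have h4 := D.loop_add_int n hb (D.at_add_one hb) hx (by rw [e']; exact D.at_add_one hx)
      have h5 : ∃ l : ℤ, D.loop hb (D.at_add_one ha) = D.loop hb (D.at_add_one hb) ^ l := by
        refine ⟨l, ?_⟩
        rw [← h3, ← h4, D.loop_congr rfl e _ _ hx hy,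
          D.loop_congr rfl e' _ _ hx (D.at_add_one hx), hl]
      exact (T.out 3 0).1 h5
    · exfalso
      have h1 : (n : ℝ) < m := by linarith
      have h2 : (m : ℝ) < n + 1 := by linarith
      have := bd _ _ h2
      norm_cast at h1
      omega
  tfae_have 1 → 2 := h0
  tfae_have 2 → 1 := fun h => ⟨a, b, ha, hb, hab, hba, h⟩
  tfae_have 2 ↔ 3 := T.out 0 1
  tfae_have 2 ↔ 4 := T.out 0 2
  tfae_have 2 ↔ 5 := T.out 0 3
  tfae_finish

open Classical in
/-- The homotopy weak parity: `0` at the even crossings and `1` at the odd ones. -/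
def homotopyParity (𝒦 : DiagramCategory S) (D : 𝒦.Obj) (v : (𝒦.flat D).Crossing) : ZMod 2 :=
  if (𝒦.flat D).IsEven v then 0 else 1

end SurfaceKnots

end

/-!
For reals `s`, `t` and a set `X`, write `D.ArcInto X s t` if the part of the diagram `D` from the
parameter `s` to the parameter `t` is homotopic, with fixed endpoints, to a path inside `X`.  Since
the `l`-th power of the whole diagram, traversed from the parameter `a`, is the part from `a` to
`a + l`, a crossing `v = D.at s = D.at t` is even if and only if `D.ArcInto {v} s (t + l)` for some
integer `l` (`FlatDiagram.isEven_iff`).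

An isotopy transports such arcs by a homeomorphism.  In a Reidemeister move the two diagrams are
homotopic, by the straight line homotopy in the disc of the move, relative to the parameters that
lie outside the open disc (`LocalChange.arcInto`).  This gives (Ψ0).

Paths in the disc are determined up to homotopy by their endpoints.  Hence, for points in the disc,
`D.ArcInto B.carrier` is an equivalence relation of parameters, it holds along every strand, and at
a crossing in the disc `{v}` may be replaced by the whole disc `B.carrier`.  So a crossing of the
strands `i` and `j` is even if and only if these strands are linked, that is
`D.ArcInto B.carrier (start i) (start j + l)` for some `l` (`LocalChange.isEven_iff_linked`).
This depends on the two strands alone, which gives (Ψ2); it is the same before and after the move,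
since the endpoints of the strands lie on the boundary of the disc; and linking is a transitive
relation of strands, so that of the three crossings of a third move exactly one can never be odd.
-/

namespace SurfaceKnots

variable {S : Type*} [TopologicalSpace S]

/-! ### Arcs homotopic into a set -/

/-- The part of the diagram from the parameter `s` to the parameter `t` is homotopic, with fixed
endpoints, to a path inside `X`. -/
def FlatDiagram.ArcInto (D : FlatDiagram S) (X : Set S) (s t : ℝ) : Prop :=
  ∃ p : Path (D.at s) (D.at t), range p ⊆ X ∧ (D.arc s t).Homotopic p

/-- Any path in the real line is homotopic to the segment with the same endpoints. -/
theorem FlatDiagram.arc_homotopic_map (D : FlatDiagram S) {s t : ℝ} (p : Path s t) :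
    (D.arc s t).Homotopic (p.map D.continuous_at) :=
  (SimplyConnectedSpace.paths_homotopic (Path.segment s t) p).map ⟨D.at, D.continuous_at⟩

theorem FlatDiagram.ArcInto.mono {D : FlatDiagram S} {X Y : Set S} {s t : ℝ}
    (h : D.ArcInto X s t) (hXY : X ⊆ Y) : D.ArcInto Y s t := by
  obtain ⟨p, hp, h⟩ := h
  exact ⟨p, hp.trans hXY, h⟩

theorem FlatDiagram.ArcInto.symm {D : FlatDiagram S} {X : Set S} {s t : ℝ}
    (h : D.ArcInto X s t) : D.ArcInto X t s := by
  obtain ⟨p, hp, h⟩ := h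
  refine ⟨p.symm, by rwa [Path.symm_range], ?_⟩
  exact (D.arc_homotopic_map (Path.segment s t).symm).trans h.symm₂

theorem FlatDiagram.ArcInto.trans {D : FlatDiagram S} {X : Set S} {r s t : ℝ}
    (h : D.ArcInto X r s) (h' : D.ArcInto X s t) : D.ArcInto X r t := by
  obtain ⟨p, hp, h⟩ := h
  obtain ⟨q, hq, h'⟩ := h'
  refine ⟨p.trans q, by rw [Path.trans_range]; exact union_subset hp hq, ?_⟩
  have e := D.arc_homotopic_map ((Path.segment r s).trans (Path.segment s t))
  rw [Path.map_trans] at e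
  exact e.trans (h.hcomp h')

theorem FlatDiagram.ArcInto.add_int {D : FlatDiagram S} {X : Set S} {s t : ℝ}
    (h : D.ArcInto X s t) (n : ℤ) : D.ArcInto X (s + n) (t + n) := by
  obtain ⟨p, hp, ⟨h⟩⟩ := h
  refine ⟨p.cast (D.at_add_int s n) (D.at_add_int t n), hp, ?_⟩
  have e : D.arc (s + n) (t + n) = (D.arc s t).cast (D.at_add_int s n) (D.at_add_int t n) := by
    ext x
    have h : Path.segment (s + n) (t + n) x = Path.segment s t x + n := by
      simp [Path.segment, AffineMap.lineMap_apply]; ring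
    simp only [FlatDiagram.arc, Path.cast_coe, Path.map_coe, Function.comp_apply, h,
      D.at_add_int]
  rw [e]
  exact ⟨h.cast rfl rfl⟩

theorem FlatDiagram.arcInto_of_Icc {D : FlatDiagram S} {X : Set S} {s t : ℝ} (hst : s ≤ t)
    (h : ∀ x ∈ Icc s t, D.at x ∈ X) : D.ArcInto X s t := by
  refine ⟨D.arc s t, ?_, .refl _⟩
  rintro _ ⟨x, rfl⟩
  refine h _ ?_
  have := Path.range_segment s t
  rw [segment_eq_Icc hst] at this
  rw [← this]
  exact mem_range_self x

/-- A continuous map and a change of parameter transport arcs. -/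
theorem FlatDiagram.ArcInto.map {D D' : FlatDiagram S} {v : S} {g : S → S} (hg : Continuous g)
    {φ : ℝ → ℝ} (hφ : Continuous φ) (hD : ∀ x, D'.at x = g (D.at (φ x))) {s t : ℝ}
    (h : D.ArcInto {v} (φ s) (φ t)) : D'.ArcInto {g v} s t := by
  obtain ⟨p, hp, h⟩ := h
  refine ⟨(p.map hg).cast (hD s) (hD t), ?_, ?_⟩
  · rintro _ ⟨x, rfl⟩
    exact congrArg g (hp (mem_range_self x))
  · have e := (D.arc_homotopic_map ((Path.segment s t).map hφ)).symm.trans h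
    obtain ⟨e⟩ := e.map ⟨g, hg⟩
    have e' : D'.arc s t = ((((Path.segment s t).map hφ).map D.continuous_at).map hg).cast
        (hD s) (hD t) := by
      ext x
      exact hD _
    rw [e']
    exact ⟨e.cast rfl rfl⟩

/-! ### Evenness in terms of arcs -/

theorem FlatDiagram.loop_self (D : FlatDiagram S) {v : S} {a : ℝ} (ha : D.at a = v) :
    D.loop ha ha = 1 :=
  mul_eq_left.1 (D.loop_mul ha ha ha)

theorem FlatDiagram.at_int {D : FlatDiagram S} {v : S} {a : ℝ} (ha : D.at a = v) (n : ℤ) :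
    D.at (a + n) = v := by
  rw [D.at_add_int, ha]

/-- The powers of the class of the diagram are represented by its multiple traversals. -/
theorem FlatDiagram.loop_zpow (D : FlatDiagram S) {v : S} {a : ℝ} (ha : D.at a = v) (l : ℤ) :
    D.loop ha (D.at_add_one ha) ^ l = D.loop ha (D.at_int ha l) := by
  have step : ∀ n : ℤ, D.loop ha (D.at_int ha (n + 1)) =
      D.loop ha (D.at_add_one ha) * D.loop ha (D.at_int ha n) := by
    intro n
    have e : a + 1 + n = a + ((n + 1 : ℤ) : ℝ) := by push_cast; ring
    rw [← D.loop_mul ha (D.at_int ha n) (D.at_int ha (n + 1)),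
      ← D.loop_add_int n ha (D.at_add_one ha) (D.at_int ha n) (by rw [e]; exact D.at_int ha _)]
    exact congrArg (· * _) (D.loop_congr rfl e.symm _ _ _ _)
  induction l with
  | zero => rw [zpow_zero, D.loop_congr rfl (by simp) ha (D.at_int ha 0) ha ha, D.loop_self]
  | succ n ih => rw [step, ← ih, add_comm (n : ℤ), zpow_add, zpow_one]
  | pred n ih =>
    have h := step (-n - 1)
    rw [D.loop_congr rfl (by simp) ha _ ha (D.at_int ha (-n)), ← ih] at h
    rw [sub_eq_neg_add, zpow_add, zpow_neg_one, h, inv_mul_cancel_left,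
      D.loop_congr rfl (by rw [sub_eq_neg_add]) ha (D.at_int ha (-n - 1)) ha
        (D.at_int ha (-1 + -n))]

theorem FlatDiagram.loop_eq_one_iff (D : FlatDiagram S) {v : S} {a b : ℝ} (ha : D.at a = v)
    (hb : D.at b = v) : D.loop ha hb = 1 ↔ D.ArcInto {v} a b := by
  have h1 : D.loop ha hb = 1 ↔
      ((D.arc a b).cast ha.symm hb.symm).Homotopic (Path.refl v) :=
    Path.Homotopic.Quotient.eq
  rw [h1]
  constructor
  · rintro ⟨h⟩
    refine ⟨(Path.refl v).cast ha hb, by rintro _ ⟨x, rfl⟩; rfl, ⟨?_⟩⟩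
    exact h.cast rfl rfl
  · rintro ⟨p, hp, ⟨h⟩⟩
    have e : p.cast ha.symm hb.symm = Path.refl v := by
      ext x
      exact hp (mem_range_self x)
    rw [← e]
    exact ⟨h.cast rfl rfl⟩

theorem FlatDiagram.loop_eq_zpow_iff (D : FlatDiagram S) {v : S} {a b : ℝ} (ha : D.at a = v)
    (hb : D.at b = v) (l : ℤ) :
    D.loop ha hb = D.loop ha (D.at_add_one ha) ^ l ↔ D.ArcInto {v} b (a + l) := by
  rw [D.loop_zpow, ← D.loop_mul ha hb (D.at_int ha l), eq_comm, mul_eq_right, D.loop_eq_one_iff]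

/-- A crossing is even if and only if some arc between lifts of its two parameters is
null-homotopic. -/
theorem FlatDiagram.isEven_iff (D : FlatDiagram S) (v : D.Crossing) {s t : ℝ} (hs : D.at s = v.1)
    (ht : D.at t = v.1) (hst : (s : UnitAddCircle) ≠ t) :
    D.IsEven v ↔ ∃ l : ℤ, D.ArcInto {v.1} s (t + l) := by
  -- The lift `b = t + n` of `t` between `s` and `s + 1`.
  obtain ⟨n, hn⟩ : ∃ n : ℤ, s < t + n ∧ t + n < s + 1 := by
    refine ⟨⌈s - t⌉, ?_, ?_⟩
    · refine lt_of_le_of_ne (by linarith [Int.le_ceil (s - t)]) fun h => ?_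
      exact hst (coe_eq_coe_iff.2 ⟨-⌈s - t⌉, by push_cast; linarith⟩)
    · linarith [Int.ceil_lt_add_one (s - t)]
  have h : D.IsEven v ↔ ∃ l : ℤ, D.loop hs (D.at_int ht n) = D.loop hs (D.at_add_one hs) ^ l :=
    (D.isEven_tfae v hn.1 hn.2 hs (D.at_int ht n)).out 0 1
  rw [h]
  simp only [D.loop_eq_zpow_iff]
  constructor
  · rintro ⟨l, h⟩
    refine ⟨n - l, ?_⟩
    have h' := h.symm.add_int (-l)
    convert h' using 1 <;> push_cast <;> ring
  · rintro ⟨l, h⟩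
    refine ⟨n - l, ?_⟩
    have h' := h.symm.add_int (n - l)
    convert h' using 1; push_cast; ring

/-! ### Paths in a disc -/

theorem Disc.homotopic_of_range_subset (B : Disc S) {x y : S} (p q : Path x y)
    (hp : range p ⊆ B.carrier) (hq : range q ⊆ B.carrier) : p.Homotopic q := by
  have hx : x ∈ B.carrier := by simpa using hp (mem_range_self 0)
  have hy : y ∈ B.carrier := by simpa using hp (mem_range_self 1)
  obtain ⟨x', rfl⟩ := hx
  obtain ⟨y', rfl⟩ := hy
  have : ContractibleSpace (Metric.closedBall (0 : EuclideanSpace ℝ (Fin 2)) 1) :=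
    (convex_closedBall _ _).contractibleSpace ⟨0, by simp⟩
  have lift : ∀ r : Path (B.toFun x') (B.toFun y'), range r ⊆ B.carrier →
      ∃ r' : Path x' y', r = r'.map B.isEmbedding.continuous := by
    intro r hr
    choose f hf using fun τ => hr (mem_range_self τ)
    have hc : Continuous f := by
      rw [B.isEmbedding.continuous_iff]
      exact r.continuous.congr fun τ => (hf τ).symm
    refine ⟨⟨⟨f, hc⟩, B.isEmbedding.injective ?_, B.isEmbedding.injective ?_⟩, ?_⟩
    · exact (hf 0).trans r.source
    · exact (hf 1).trans r.target
    · ext τ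
      exact (hf τ).symm
  obtain ⟨p', rfl⟩ := lift p hp
  obtain ⟨q', rfl⟩ := lift q hq
  exact (SimplyConnectedSpace.paths_homotopic p' q').map ⟨_, B.isEmbedding.continuous⟩

/-- For a loop of the diagram at a point of the disc, being homotopic into the disc means being
null-homotopic. -/
theorem FlatDiagram.arcInto_carrier_iff (D : FlatDiagram S) (B : Disc S) {v : S} {s t : ℝ}
    (hv : v ∈ B.carrier) (hs : D.at s = v) (ht : D.at t = v) :
    D.ArcInto B.carrier s t ↔ D.ArcInto {v} s t := by
  refine ⟨?_, fun h => h.mono (singleton_subset_iff.2 hv)⟩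
  rintro ⟨p, hp, h⟩
  have hq : range ((Path.refl v).cast hs ht) ⊆ {v} := by
    rintro _ ⟨x, rfl⟩
    rfl
  exact ⟨_, hq, h.trans (B.homotopic_of_range_subset _ _ hp
    (hq.trans (singleton_subset_iff.2 hv)))⟩

/-! ### The homotopy of a local change -/

theorem LocalChange.mem_carrier_iff {D D' : FlatDiagram S} {k : ℕ} (m : LocalChange D D' k)
    (x : UnitAddCircle) : D'.curve x ∈ m.disc.carrier ↔ D.curve x ∈ m.disc.carrier := by
  change x ∈ D'.curve ⁻¹' m.disc.carrier ↔ x ∈ D.curve ⁻¹' m.disc.carrier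
  rw [m.preimage_disc, m.preimage_disc']

theorem LocalChange.isClosed_notMem_interior {D D' : FlatDiagram S} {k : ℕ}
    (m : LocalChange D D' k) : IsClosed {x | D.curve x ∉ m.disc.interior} := by
  have h : IsOpen (D.curve ⁻¹' m.disc.interior) := by
    rw [m.preimage_interior]
    exact isOpen_iUnion fun i => QuotientAddGroup.isOpenMap_coe _ isOpen_Ioo
  exact h.isClosed_compl

theorem Disc.isClosed_carrier [T2Space S] (B : Disc S) : IsClosed B.carrier :=
  (isCompact_range B.isEmbedding.continuous).isClosed

/-- Two diagrams that differ by a local change are homotopic relative to the parameters outside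
the open disc, by the straight line homotopy in the disc. -/
theorem LocalChange.exists_homotopy [T2Space S] {D D' : FlatDiagram S} {k : ℕ}
    (m : LocalChange D D' k) :
    ∃ H : D.curve.Homotopy D'.curve, ∀ x, D.curve x ∉ m.disc.interior →
      ∀ τ, H (τ, x) = D.curve x := by
  classical
  let E := m.disc.isEmbedding.toHomeomorph
  let A : Set (unitInterval × UnitAddCircle) := {z | D.curve z.2 ∈ m.disc.carrier}
  have hA : IsClosed A :=
    m.disc.isClosed_carrier.preimage (D.curve.continuous.comp continuous_snd)
  let C : Set (unitInterval × UnitAddCircle) := {z | D.curve z.2 ∉ m.disc.interior}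
  have hC : IsClosed C := m.isClosed_notMem_interior.preimage continuous_snd
  let f : A → Metric.closedBall (0 : EuclideanSpace ℝ (Fin 2)) 1 :=
    fun z => E.symm ⟨D.curve z.1.2, z.2⟩
  let f' : A → Metric.closedBall (0 : EuclideanSpace ℝ (Fin 2)) 1 :=
    fun z => E.symm ⟨D'.curve z.1.2, (m.mem_carrier_iff _).2 z.2⟩
  have hf : Continuous f := by fun_prop
  have hf' : Continuous f' := by fun_prop
  have Ef : ∀ z, m.disc.toFun (f z) = D.curve z.1.2 := fun z =>
    congrArg Subtype.val (E.apply_symm_apply ⟨D.curve z.1.2, z.2⟩)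
  have Ef' : ∀ z, m.disc.toFun (f' z) = D'.curve z.1.2 := fun z =>
    congrArg Subtype.val (E.apply_symm_apply ⟨D'.curve z.1.2, (m.mem_carrier_iff _).2 z.2⟩)
  let g : A → Metric.closedBall (0 : EuclideanSpace ℝ (Fin 2)) 1 := fun z =>
    ⟨AffineMap.lineMap (f z).1 (f' z).1 (z.1.1 : ℝ),
      (convex_closedBall _ _).lineMap_mem (f z).2 (f' z).2 z.1.1.2⟩
  have hg : Continuous g := by
    refine Continuous.subtype_mk ?_ _
    simp only [AffineMap.lineMap_apply_module]
    fun_prop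
  let H : unitInterval × UnitAddCircle → S := fun z =>
    if h : z ∈ A then m.disc.toFun (g ⟨z, h⟩) else D.curve z.2
  have HA : ∀ z (h : z ∈ A), H z = m.disc.toFun (g ⟨z, h⟩) := fun z h => dif_pos h
  have HC : ∀ z ∈ C, H z = D.curve z.2 := by
    intro z hz
    by_cases h : z ∈ A
    · -- On the boundary circle both diagrams agree, so that the line is constant.
      have e : f' ⟨z, h⟩ = f ⟨z, h⟩ := by
        apply m.disc.isEmbedding.injective
        rw [Ef, Ef', m.agree _ hz]
      have e' : g ⟨z, h⟩ = f ⟨z, h⟩ := by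
        apply Subtype.ext
        simp only [g, e, AffineMap.lineMap_same, AffineMap.const_apply]
      rw [HA z h, e', Ef]
    · exact dif_neg h
  have hH : Continuous H := by
    rw [← continuousOn_univ, ← (eq_univ_of_forall fun z => ?_ : A ∪ C = univ)]
    · refine ContinuousOn.union_of_isClosed ?_ ?_ hA hC
      · rw [continuousOn_iff_continuous_domRestrict]
        exact (m.disc.isEmbedding.continuous.comp hg).congr fun z => (HA z.1 z.2).symm
      · exact (D.curve.continuous.comp continuous_snd).continuousOn.congr HC
    · by_cases h : D.curve z.2 ∈ m.disc.interior
      · exact Or.inl (Disc.mem_carrier h)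
      · exact Or.inr h
  refine ⟨⟨⟨H, hH⟩, fun x => ?_, fun x => ?_⟩, fun x hx τ => HC (τ, x) hx⟩
  · by_cases h : D.curve x ∈ m.disc.carrier
    · refine (HA (0, x) h).trans ?_
      rw [← Ef ⟨(0, x), h⟩]
      congr 1
      apply Subtype.ext
      simp [g]
    · exact dif_neg h
  · by_cases h : D.curve x ∈ m.disc.carrier
    · refine (HA (1, x) h).trans ?_
      rw [← Ef' ⟨(1, x), h⟩]
      congr 1
      apply Subtype.ext
      simp [g]
    · exact (dif_neg h).trans (m.agree x fun h' => h (Disc.mem_carrier h'))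

/-- A local change does not affect the homotopy classes of the arcs with endpoints outside the open
disc. -/
theorem LocalChange.arcInto [T2Space S] {D D' : FlatDiagram S} {k : ℕ} (m : LocalChange D D' k)
    {X : Set S} {s t : ℝ} (hs : D.at s ∉ m.disc.interior) (ht : D.at t ∉ m.disc.interior)
    (h : D.ArcInto X s t) : D'.ArcInto X s t := by
  obtain ⟨H, hH⟩ := m.exists_homotopy
  obtain ⟨p, hp, ⟨h⟩⟩ := h
  have es : D'.at s = D.at s := (m.agree _ hs).symm
  have et : D'.at t = D.at t := (m.agree _ ht).symm
  refine ⟨p.cast es et, hp, ?_⟩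
  have e : (D.arc s t).Homotopic ((D'.arc s t).cast es.symm et.symm) := by
    refine ⟨⟨⟨⟨fun z => H (z.1, (Path.segment s t z.2 : UnitAddCircle)), ?_⟩, ?_, ?_⟩, ?_⟩⟩
    · exact H.continuous.comp (continuous_fst.prodMk ((AddCircle.continuous_mk' 1).comp
        ((Path.segment s t).continuous.comp continuous_snd)))
    · intro x
      exact H.apply_zero _
    · intro x
      exact H.apply_one _
    · rintro τ x (rfl | rfl)
      · have e := hH (s : UnitAddCircle) hs τ
        rw [← Path.source (Path.segment s t)] at e
        exact e
      · have e := hH (t : UnitAddCircle) ht τ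
        rw [← Path.target (Path.segment s t)] at e
        exact e
  obtain ⟨e⟩ := e.symm.trans ⟨h⟩
  exact ⟨e.cast rfl rfl⟩

/-! ### Crossings that do not participate -/

theorem LocalChange.isEven_push [T2Space S] {D D' : FlatDiagram S} {k : ℕ}
    (m : LocalChange D D' k) (v : D.Crossing) (hv : v.1 ∉ m.disc.interior) :
    D.IsEven v ↔ D'.IsEven (m.push v hv) := by
  obtain ⟨s, t, hst, hs, ht⟩ := id v.2
  obtain ⟨s, rfl⟩ := QuotientAddGroup.mk_surjective s
  obtain ⟨t, rfl⟩ := QuotientAddGroup.mk_surjective t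
  have hs' : D'.at s = v.1 := by rw [← hs]; exact (m.agree _ (by rwa [hs])).symm
  have ht' : D'.at t = v.1 := by rw [← ht]; exact (m.agree _ (by rwa [ht])).symm
  rw [D.isEven_iff v hs ht hst, D'.isEven_iff (m.push v hv) hs' ht' hst]
  refine exists_congr fun l => ⟨m.arcInto ?_ ?_, m.symm.arcInto ?_ ?_⟩
  · rwa [show D.at s = v.1 from hs]
  · rwa [D.at_int ht l]
  · rw [hs']; exact hv
  · rw [D'.at_int ht' l]; exact hv

theorem Isotopy.isEven_push {D D' : FlatDiagram S} (f : Isotopy D D') (v : D.Crossing) :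
    D.IsEven v ↔ D'.IsEven (f.push v) := by
  obtain ⟨s, t, hst, hs, ht⟩ := id (f.push v).2
  obtain ⟨s, rfl⟩ := QuotientAddGroup.mk_surjective s
  obtain ⟨t, rfl⟩ := QuotientAddGroup.mk_surjective t
  let F := (f.isHomeomorph 1).homeomorph
  have hF : ∀ x, F x = f.F (1, x) := fun _ => rfl
  have hmap : ∀ x, D.at x = F.symm (D'.at (f.reparam.symm x)) := by
    intro x
    rw [f.map_curve, f.reparam.apply_symm_apply, ← hF, F.symm_apply_apply]
  have param : ∀ x, D'.at x = (f.push v).1 → D.at (f.reparam x) = v.1 := by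
    intro x hx
    rw [f.map_curve] at hx
    exact F.injective hx
  have hst' : ((f.reparam s : ℝ) : UnitAddCircle) ≠ (f.reparam t : ℝ) := by
    intro h
    obtain ⟨n, hn⟩ := coe_eq_coe_iff.1 h
    refine hst (coe_eq_coe_iff.2 ⟨n * f.sgn, f.reparam.injective ?_⟩)
    rw [hn, f.reparam_add_int, mul_assoc, Int.units_coe_mul_self, mul_one]
  rw [D.isEven_iff v (param s hs) (param t ht) hst', D'.isEven_iff (f.push v) hs ht hst]
  constructor
  · rintro ⟨l, h⟩
    refine ⟨l * f.sgn, .map F.continuous f.reparam.continuous f.map_curve ?_⟩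
    rwa [f.reparam_add_int, mul_assoc, Int.units_coe_mul_self, mul_one]
  · rintro ⟨l, h⟩
    refine ⟨l * f.sgn, ?_⟩
    have e : F.symm (f.push v).1 = v.1 := F.symm_apply_apply v.1
    rw [← e, ← f.reparam_add_int]
    refine .map F.symm.continuous f.reparam.symm.continuous hmap ?_
    rwa [f.reparam.symm_apply_apply, f.reparam.symm_apply_apply]

theorem Move.isEven_push [T2Space S] {D D' : FlatDiagram S} (f : Move D D') (v : D.Crossing)
    (hv : v ∉ f.participants) : D.IsEven v ↔ D'.IsEven (f.push v hv) := by
  cases f with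
  | isotopy f => exact f.isEven_push v
  | r1 m =>
    exact m.toLocalChange.isEven_push v fun h => hv ((m.mem_disc_iff v).1 (Disc.mem_carrier h))
  | r1Inv m =>
    exact m.toLocalChange.symm.isEven_push v fun h => m.notMem_disc' v (Disc.mem_carrier h)
  | r2 m =>
    exact m.toLocalChange.isEven_push v fun h => hv ((m.mem_disc_iff v).1 (Disc.mem_carrier h))
  | r2Inv m =>
    exact m.toLocalChange.symm.isEven_push v fun h => m.notMem_disc' v (Disc.mem_carrier h)
  | r3 m =>
    refine m.toLocalChange.isEven_push v fun h => hv ?_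
    obtain ⟨k, hk⟩ := (m.mem_disc_iff v).1 (Disc.mem_carrier h)
    exact ⟨k, hk.symm⟩

/-! ### Linked strands -/

/-- The strands `i` and `j` are linked: the arc of the diagram between their initial points, for
some lift of the parameter of the second one, is homotopic into the disc.  In other words, suitable
lifts of the two strands to the universal covering lie in the same lift of the disc. -/
def LocalChange.Linked {D D' : FlatDiagram S} {k : ℕ} (m : LocalChange D D' k) (i j : Fin k) :
    Prop :=
  ∃ l : ℤ, D.ArcInto m.disc.carrier (m.start i) (m.start j + l)

theorem LocalChange.Linked.symm {D D' : FlatDiagram S} {k : ℕ} {m : LocalChange D D' k}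
    {i j : Fin k} (h : m.Linked i j) : m.Linked j i := by
  obtain ⟨l, h⟩ := h
  refine ⟨-l, ?_⟩
  simpa using h.symm.add_int (-l)

theorem LocalChange.Linked.trans {D D' : FlatDiagram S} {k : ℕ} {m : LocalChange D D' k}
    {i j n : Fin k} (h : m.Linked i j) (h' : m.Linked j n) : m.Linked i n := by
  obtain ⟨l, h⟩ := h
  obtain ⟨l', h'⟩ := h'
  refine ⟨l' + l, h.trans ?_⟩
  have := h'.add_int l
  rwa [add_assoc, ← Int.cast_add] at this

theorem LocalChange.start_notMem {D D' : FlatDiagram S} {k : ℕ} (m : LocalChange D D' k)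
    (i : Fin k) : D.at (m.start i) ∉ m.disc.interior := by
  intro h
  have h' : (m.start i : UnitAddCircle) ∈ D.curve ⁻¹' m.disc.interior := h
  rw [m.preimage_interior, mem_iUnion] at h'
  obtain ⟨j, y, hy, hyi⟩ := h'
  obtain ⟨n, hn⟩ := coe_eq_coe_iff.1 hyi
  have h1 := m.fin_lt_period i j
  have h2 := m.fin_lt_period j i
  have h3 := m.start_lt_fin i
  have hn1 : (n : ℝ) < 1 := by linarith [hy.1]
  have hn2 : (-1 : ℝ) < n := by linarith [hy.2]
  norm_cast at hn1 hn2
  obtain rfl : n = 0 := by omega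
  rw [Int.cast_zero, add_zero] at hn
  rcases lt_trichotomy i j with hij | rfl | hij
  · linarith [m.fin_lt_start i j hij, hy.1]
  · linarith [hy.1]
  · linarith [m.fin_lt_start j i hij, hy.2]

/-- Linking is not affected by the local change. -/
theorem LocalChange.linked_symm_iff [T2Space S] {D D' : FlatDiagram S} {k : ℕ}
    (m : LocalChange D D' k) (i j : Fin k) : m.symm.Linked i j ↔ m.Linked i j := by
  refine exists_congr fun l => ⟨m.symm.arcInto ?_ ?_, m.arcInto ?_ ?_⟩
  · exact m.symm.start_notMem i
  · rw [D'.at_add_int]; exact m.symm.start_notMem j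
  · exact m.start_notMem i
  · rw [D.at_add_int]; exact m.start_notMem j

theorem LocalChange.arcInto_strand {D D' : FlatDiagram S} {k : ℕ} (m : LocalChange D D' k)
    (i : Fin k) {s : ℝ} (hs : s ∈ Ioo (m.start i) (m.fin i)) :
    D.ArcInto m.disc.carrier (m.start i) s := by
  refine FlatDiagram.arcInto_of_Icc hs.1.le fun x hx => ?_
  have h : (x : UnitAddCircle) ∈ D.curve ⁻¹' m.disc.carrier := by
    rw [m.preimage_disc, mem_iUnion]
    exact ⟨i, x, ⟨hx.1, hx.2.trans hs.2.le⟩, rfl⟩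
  exact h

theorem LocalChange.coe_ne_coe {D D' : FlatDiagram S} {k : ℕ} (m : LocalChange D D' k)
    {i j : Fin k} (hij : i ≠ j) {s t : ℝ} (hs : s ∈ Ioo (m.start i) (m.fin i))
    (ht : t ∈ Ioo (m.start j) (m.fin j)) : (s : UnitAddCircle) ≠ t := by
  wlog h : i < j generalizing i j s t
  · exact (this hij.symm ht hs (lt_of_le_of_ne (not_lt.1 h) hij.symm)).symm
  intro e
  obtain ⟨n, hn⟩ := coe_eq_coe_iff.1 e
  have hn1 : (0 : ℝ) < n := by linarith [m.fin_lt_start i j h, hs.2, ht.1]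
  have hn2 : (n : ℝ) < 1 := by linarith [m.fin_lt_period j i, hs.1, ht.2]
  norm_cast at hn1 hn2
  omega

/-- A crossing of two different strands is even if and only if the strands are linked. -/
theorem LocalChange.isEven_iff_linked {D D' : FlatDiagram S} {k : ℕ} (m : LocalChange D D' k)
    (v : D.Crossing) {i j : Fin k} (hij : i ≠ j) {s t : ℝ} (hs : s ∈ Ioo (m.start i) (m.fin i))
    (ht : t ∈ Ioo (m.start j) (m.fin j)) (hsv : D.at s = v.1) (htv : D.at t = v.1) :
    D.IsEven v ↔ m.Linked i j := by
  have hi := m.arcInto_strand i hs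
  have hj := m.arcInto_strand j ht
  have hv : v.1 ∈ m.disc.carrier := by
    obtain ⟨p, hp, -⟩ := hi
    simpa [hsv] using hp (mem_range_self 1)
  rw [D.isEven_iff v hsv htv (m.coe_ne_coe hij hs ht)]
  refine exists_congr fun l => ?_
  rw [← D.arcInto_carrier_iff m.disc hv hsv (D.at_int htv l)]
  exact ⟨fun h => (hi.trans h).trans (hj.add_int l).symm,
    fun h => (hi.symm.trans h).trans (hj.add_int l)⟩

/-! ### Crossings that participate -/

theorem R2Move.isEven_iff {D D' : FlatDiagram S} (m : R2Move D D') :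
    D.IsEven m.u ↔ D.IsEven m.v := by
  have key : ∀ c : D.Crossing, (∀ i, ∃ x ∈ m.strand i, D.curve x = c.1) →
      (D.IsEven c ↔ m.Linked 0 1) := by
    intro c hc
    obtain ⟨_, ⟨s, hs, rfl⟩, hs'⟩ := hc 0
    obtain ⟨_, ⟨t, ht, rfl⟩, ht'⟩ := hc 1
    exact m.isEven_iff_linked c (by decide) hs ht hs' ht'
  rw [key _ m.u_mem, key _ m.v_mem]

theorem R3Move.isEven_iff_linked {D D' : FlatDiagram S} (m : R3Move D D') {i j k : Fin 3}
    (hij : i ≠ j) (hik : i ≠ k) (hjk : j ≠ k) : D.IsEven (m.c k) ↔ m.Linked i j :=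
  m.toLocalChange.isEven_iff_linked (m.c k) hij (m.p_mem i k hik) (m.p_mem j k hjk)
    (m.at_p i k hik) (m.at_p j k hjk)

theorem R3Move.isEven_iff_linked' [T2Space S] {D D' : FlatDiagram S} (m : R3Move D D')
    {i j k : Fin 3} (hij : i ≠ j) (hik : i ≠ k) (hjk : j ≠ k) :
    D'.IsEven (m.c' k) ↔ m.Linked i j :=
  (m.toLocalChange.symm.isEven_iff_linked (m.c' k) hij (m.p_mem' i k hik) (m.p_mem' j k hjk)
    (m.at_p' i k hik) (m.at_p' j k hjk)).trans (m.linked_symm_iff i j)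

theorem homotopyParity_eq_iff {𝒦 : DiagramCategory S} {D D' : 𝒦.Obj} {v : (𝒦.flat D).Crossing}
    {v' : (𝒦.flat D').Crossing} (h : (𝒦.flat D).IsEven v ↔ (𝒦.flat D').IsEven v') :
    homotopyParity 𝒦 D v = homotopyParity 𝒦 D' v' := by
  unfold homotopyParity
  by_cases hv : (𝒦.flat D).IsEven v
  · rw [if_pos hv, if_pos (h.1 hv)]
  · rw [if_neg hv, if_neg fun hv' => hv (h.2 hv')]

/-- The homotopy parity is a weak parity on every category of diagrams in a Hausdorff space. -/
theorem isWeakParity_homotopyParity [T2Space S] (𝒦 : DiagramCategory S) :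
    IsWeakParity 𝒦 (homotopyParity 𝒦) where
  psi0 _ _ f _ v hv := homotopyParity_eq_iff (f.isEven_push v hv)
  psi2 _ _ m _ := homotopyParity_eq_iff m.isEven_iff
  psi3 D D' m _ := by
    refine ⟨fun k => homotopyParity_eq_iff ?_, ?_⟩
    · obtain ⟨i, j, hij, hik, hjk⟩ : ∃ i j : Fin 3, i ≠ j ∧ i ≠ k ∧ j ≠ k := by
        revert k; decide
      rw [m.isEven_iff_linked hij hik hjk, m.isEven_iff_linked' hij hik hjk]
    · have h0 := m.isEven_iff_linked (i := 1) (j := 2) (k := 0) (by decide) (by decide) (by decide)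
      have h1 := m.isEven_iff_linked (i := 0) (j := 2) (k := 1) (by decide) (by decide) (by decide)
      have h2 := m.isEven_iff_linked (i := 0) (j := 1) (k := 2) (by decide) (by decide) (by decide)
      simp only [homotopyParity, h0, h1, h2]
      have t0 : m.Linked 0 1 → m.Linked 0 2 → m.Linked 1 2 := fun h h' => h.symm.trans h'
      have t1 : m.Linked 0 1 → m.Linked 1 2 → m.Linked 0 2 := fun h h' => h.trans h'
      have t2 : m.Linked 0 2 → m.Linked 1 2 → m.Linked 0 1 := fun h h' => h.trans h'.symm
      have v1 : (1 : ZMod 2).val = 1 := rfl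
      split_ifs <;> simp_all

end SurfaceKnots

theorem mainTheorem9 {S : Type*} [TopologicalSpace S] [T2Space S] [CompactSpace S]
    [ConnectedSpace S] [ChartedSpace (EuclideanSpace ℝ (Fin 2)) S] :
    (∀ K : SurfaceKnots.Knot S,
      SurfaceKnots.IsWeakParity K.diagrams (SurfaceKnots.homotopyParity K.diagrams)) ∧
    (∀ K : SurfaceKnots.FlatKnot S,
      SurfaceKnots.IsWeakParity K.diagrams (SurfaceKnots.homotopyParity K.diagrams)) :=
  ⟨fun K => SurfaceKnots.isWeakParity_homotopyParity K.diagrams,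
    fun K => SurfaceKnots.isWeakParity_homotopyParity K.diagrams⟩
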